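/- **Languages and semantics.** Let $\mathrm{Prop}$ be a countable set of propositional letters with a fixed letter $p_0$. $\mathscr L(\to,\prec)$ is the set of formulas built from letters by $\neg,\wedge,\vee,\to,\prec$, and $\mathscr L(\rightarrowtail,\multimap)$ the set of formulas built by $\neg,\wedge,\vee,\rightarrowtail,\multimap$ ($\prec$ and $\multimap$ are co-implications). On $[0,1]$ put $a\to_{\mathsf G}b=1$ if $a\le b$ and $=b$ otherwise, and $a\prec_{\mathsf G}b=0$ if $a\le b$ and $=a$ otherwise. A valuation is a pair $e=(e_1,e_2)$ of maps $\mathrm{Prop}\to[0,1]$, extended to formulas by $$\begin{array}{ll} e_1(\neg\phi)=e_2(\phi), & e_2(\neg\phi)=e_1(\phi),\\ e_1(\phi\wedge\chi)=\min(e_1(\phi),e_1(\chi)), & e_2(\phi\wedge\chi)=\max(e_2(\phi),e_2(\chi)),\\ e_1(\phi\vee\chi)=\max(e_1(\phi),e_1(\chi)), & e_2(\phi\vee\chi)=\min(e_2(\phi),e_2(\chi)),\\ e_1(\phi\to\chi)=e_1(\phi)\to_{\mathsf G}e_1(\chi), & e_2(\phi\to\chi)=e_2(\chi)\prec_{\mathsf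 G}e_2(\phi),\\ e_1(\phi\prec\chi)=e_1(\phi)\prec_{\mathsf G}e_1(\chi), & e_2(\phi\prec\chi)=e_2(\chi)\to_{\mathsf G}e_2(\phi),\\ e_1(\phi\rightarrowtail\chi)=e_1(\phi)\to_{\mathsf G}e_1(\chi), & e_2(\phi\rightarrowtail\chi)=\min(e_1(\phi),e_2(\chi)),\\ e_1(\phi\multimap\chi)=e_1(\phi)\prec_{\mathsf G}e_1(\chi), & e_2(\phi\multimap\chi)=\max(e_2(\phi),e_1(\chi)). \end{array}$$ For $\Gamma\cup\{\phi\}\subseteq\mathscr L(\to,\prec)$, $\Gamma\models_{\mathsf G^2(\to,\prec)}\phi$ means that for every valuation $e$ both $\inf_{\psi\in\Gamma}e_1(\psi)\le e_1(\phi)$ and $\sup_{\psi\in\Gamma}e_2(\psi)\ge e_2(\phi)$. For $\Gamma\cup\{\phi\}\subseteq\mathscr L(\rightarrowtail,\multimap)$, $\Gamma\models_{\mathsf G^2(\rightarrowtail,\multimap)}\phi$ means that $\inf_{\psi\in\Gamma}e_1(\psi)\le e_1(\phi)$ for every valuation $e$. Infima and suprema are taken in $[0,1]$ ($\inf\varnothing=1$,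 $\sup\varnothing=0$). **Calculi.** Write $\top=p_0\to p_0$, $\bot=p_0\prec p_0$, ${\sim}\phi=\phi\to\bot$, $\phi\leftrightarrow\chi=(\phi\to\chi)\wedge(\chi\to\phi)$. The Hilbert calculus $\mathcal H\mathsf G^2(\to,\prec)$ has the following axiom schemas, for all formulas $\phi,\chi,\psi$: 1. $(\phi\to\chi)\to((\chi\to\psi)\to(\phi\to\psi))$; 2. $\phi\to(\phi\vee\chi)$; $\chi\to(\phi\vee\chi)$; 3. $(\phi\to\psi)\to((\chi\to\psi)\to((\phi\vee\chi)\to\psi))$; 4. $(\phi\wedge\chi)\to\phi$; $(\phi\wedge\chi)\to\chi$; 5. $(\phi\to\chi)\to((\phi\to\psi)\to(\phi\to(\chi\wedge\psi)))$; 6. $(\phi\to(\chi\to\psi))\to((\phi\wedge\chi)\to\psi)$; $((\phi\wedge\chi)\to\psi)\to(\phi\to(\chi\to\psi))$; 7. $(\phi\to\chi)\to({\sim}\chi\to{\sim}\phi)$; 8. $(\phi\prec\chi)\to(\top\prec(\phi\to\chi))$; ${\sim}(\phi\prec\chi)\to(\phi\to\chi)$; 9. $\phi\to(\chi\vee(\phi\prec\chi))$;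 $((\phi\prec\chi)\prec\psi)\to(\phi\prec(\chi\vee\psi))$; 10. (prelinearity) $(\phi\to\chi)\vee(\chi\to\phi)$; ${\sim}((\phi\prec\chi)\wedge(\chi\prec\phi))$; 11. (De Morgan) $\neg\neg\phi\leftrightarrow\phi$; $\neg(\phi\wedge\chi)\leftrightarrow(\neg\phi\vee\neg\chi)$; $\neg(\phi\vee\chi)\leftrightarrow(\neg\phi\wedge\neg\chi)$; $\neg(\phi\to\chi)\leftrightarrow(\neg\chi\prec\neg\phi)$; $\neg(\phi\prec\chi)\leftrightarrow(\neg\chi\to\neg\phi)$; and the rules modus ponens (from $\phi$ and $\phi\to\chi$ infer $\chi$) and necessitation (if $\phi$ is a theorem, i.e. derivable from $\varnothing$, infer $(\top\prec\phi)\to\bot$). The calculus $\mathcal H\mathsf G^2(\rightarrowtail,\multimap)$ is obtained by replacing $\to,\prec$ throughout (also in the abbreviations) by $\rightarrowtail,\multimap$, except that the last two De Morgan schemas become $\neg(\phi\rightarrowtail\chi)\leftrightarrow(\phi\wedge\neg\chi)$ and $\neg(\phi\multimap\chi)\leftrightarrow(\neg\phi\vee\chi)$. $\Gamma\vdash\phi$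 means that there is a finite derivation of $\phi$ from $\Gamma$. **Theorem.** Both calculi are strongly complete: for every (possibly infinite) set $\Gamma$ of formulas and every formula $\phi$ of the respective language, $$\Gamma\vdash_{\mathcal H\mathsf G^2(\to,\prec)}\phi\iff\Gamma\models_{\mathsf G^2(\to,\prec)}\phi,\qquad \Gamma\vdash_{\mathcal H\mathsf G^2(\rightarrowtail,\multimap)}\phi\iff\Gamma\models_{\mathsf G^2(\rightarrowtail,\multimap)}\phi .$$ -/

import Mathlib

/-- The two ways of treating the De Morgan negation of (co-)implication: `moisil` for the self-dual
pair `→, ⤙` and `nelson` for the Nelson-style pair `⥤, ⊸`. -/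
inductive Variant where
  | moisil
  | nelson

/-- Formulas over the letters `P`. `imp` and `coimp` stand for `→, ⤙` in `Formula .moisil P`
and for `⥤, ⊸` in `Formula .nelson P`: the two languages are different types. -/
inductive Formula (k : Variant) (P : Type*) where
  | atom (p : P)
  | neg (φ : Formula k P)
  | and (φ χ : Formula k P)
  | or (φ χ : Formula k P)
  | imp (φ χ : Formula k P)
  | coimp (φ χ : Formula k P)

namespace Formula

variable {k : Variant} {P : Type*}

/-- `⊤ := p → p`. -/
def top (p : P) : Formula k P := imp (atom p) (atom p)

/-- `⊥ := p ⤙ p`. -/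
def bot (p : P) : Formula k P := coimp (atom p) (atom p)

/-- Gödel negation `∼φ := φ → ⊥`. -/
def gneg (p : P) (φ : Formula k P) : Formula k P := imp φ (bot p)

/-- `φ ↔ χ := (φ → χ) ∧ (χ → φ)`. -/
def iff (φ χ : Formula k P) : Formula k P := and (imp φ χ) (imp χ φ)

end Formula

open Formula in
/-- The axiom instances of the bi-Gödel calculus, in either language; `p` is the letter in the
abbreviations `⊤` and `⊥`. -/
inductive BiGAxiom {k : Variant} {P : Type*} (p : P) : Formula k P → Prop where
  | trans (φ χ ψ) : BiGAxiom p (imp (imp φ χ) (imp (imp χ ψ) (imp φ ψ)))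
  | or_left (φ χ) : BiGAxiom p (imp φ (or φ χ))
  | or_right (φ χ) : BiGAxiom p (imp χ (or φ χ))
  | or_elim (φ χ ψ) : BiGAxiom p (imp (imp φ ψ) (imp (imp χ ψ) (imp (or φ χ) ψ)))
  | and_left (φ χ) : BiGAxiom p (imp (and φ χ) φ)
  | and_right (φ χ) : BiGAxiom p (imp (and φ χ) χ)
  | and_intro (φ χ ψ) : BiGAxiom p (imp (imp φ χ) (imp (imp φ ψ) (imp φ (and χ ψ))))
  | uncurry (φ χ ψ) : BiGAxiom p (imp (imp φ (imp χ ψ)) (imp (and φ χ) ψ))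
  | curry (φ χ ψ) : BiGAxiom p (imp (imp (and φ χ) ψ) (imp φ (imp χ ψ)))
  | contrapose (φ χ) : BiGAxiom p (imp (imp φ χ) (imp (gneg p χ) (gneg p φ)))
  | coimp_top (φ χ) : BiGAxiom p (imp (coimp φ χ) (coimp (top p) (imp φ χ)))
  | gneg_coimp (φ χ) : BiGAxiom p (imp (gneg p (coimp φ χ)) (imp φ χ))
  | coimp_or (φ χ) : BiGAxiom p (imp φ (or χ (coimp φ χ)))
  | coimp_coimp (φ χ ψ) :
      BiGAxiom p (imp (coimp (coimp φ χ) ψ) (coimp φ (or χ ψ)))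
  | prel (φ χ) : BiGAxiom p (or (imp φ χ) (imp χ φ))
  | coprel (φ χ) : BiGAxiom p (gneg p (and (coimp φ χ) (coimp χ φ)))

open Formula in
/-- The axiom instances for the De Morgan negation. -/
inductive DeMorganAxiom {P : Type*} : {k : Variant} → Formula k P → Prop where
  | neg_neg {k : Variant} (φ : Formula k P) : DeMorganAxiom (iff (neg (neg φ)) φ)
  | neg_and {k : Variant} (φ χ : Formula k P) :
      DeMorganAxiom (iff (neg (and φ χ)) (or (neg φ) (neg χ)))
  | neg_or {k : Variant} (φ χ : Formula k P) :
      DeMorganAxiom (iff (neg (or φ χ)) (and (neg φ) (neg χ)))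
  | moisil_imp (φ χ : Formula .moisil P) :
      DeMorganAxiom (iff (neg (imp φ χ)) (coimp (neg χ) (neg φ)))
  | moisil_coimp (φ χ : Formula .moisil P) :
      DeMorganAxiom (iff (neg (coimp φ χ)) (imp (neg χ) (neg φ)))
  | nelson_imp (φ χ : Formula .nelson P) :
      DeMorganAxiom (iff (neg (imp φ χ)) (and φ (neg χ)))
  | nelson_coimp (φ χ : Formula .nelson P) :
      DeMorganAxiom (iff (neg (coimp φ χ)) (or (neg φ) χ))

open Formula in
/-- `Derivable p Γ φ`: there is a derivation of `φ` from `Γ` in the Hilbert calculus for the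
language of `φ`. Necessitation applies to theorems only. -/
inductive Derivable {k : Variant} {P : Type*} (p : P) :
    Set (Formula k P) → Formula k P → Prop where
  | hyp {Γ : Set (Formula k P)} {φ : Formula k P} : φ ∈ Γ → Derivable p Γ φ
  | biG {Γ : Set (Formula k P)} {φ : Formula k P} : BiGAxiom p φ → Derivable p Γ φ
  | deMorgan {Γ : Set (Formula k P)} {φ : Formula k P} : DeMorganAxiom φ → Derivable p Γ φ
  | mp {Γ : Set (Formula k P)} {φ χ : Formula k P} :
      Derivable p Γ φ → Derivable p Γ (imp φ χ) → Derivable p Γ χ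
  | nec {Γ : Set (Formula k P)} {φ : Formula k P} :
      Derivable p ∅ φ → Derivable p Γ (imp (coimp (top p) φ) (bot p))

/-- Gödel implication on `[0,1]`. -/
noncomputable def gImp (a b : unitInterval) : unitInterval := if a ≤ b then 1 else b

/-- Gödel co-implication on `[0,1]`. -/
noncomputable def gCoimp (b a : unitInterval) : unitInterval := if b ≤ a then 0 else b

/-- The implication of `k` on pairs (support of truth, support of falsity). -/
noncomputable def twistImp (k : Variant) (a b : unitInterval × unitInterval) :
    unitInterval × unitInterval :=
  match k with
  | .moisil => (gImp a.1 b.1, gCoimp b.2 a.2)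
  | .nelson => (gImp a.1 b.1, a.1 ⊓ b.2)

/-- The co-implication of `k` on pairs (support of truth, support of falsity). -/
noncomputable def twistCoimp (k : Variant) (a b : unitInterval × unitInterval) :
    unitInterval × unitInterval :=
  match k with
  | .moisil => (gCoimp a.1 b.1, gImp b.2 a.2)
  | .nelson => (gCoimp a.1 b.1, a.2 ⊔ b.1)

/-- The extension `(e₁, e₂)` of a valuation of the letters in the twist product of `[0,1]` to all
formulas. -/
noncomputable def Formula.eval {k : Variant} {P : Type*} (e : P → unitInterval × unitInterval) :
    Formula k P → unitInterval × unitInterval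
  | .atom p => e p
  | .neg φ => ((φ.eval e).2, (φ.eval e).1)
  | .and φ χ => ((φ.eval e).1 ⊓ (χ.eval e).1, (φ.eval e).2 ⊔ (χ.eval e).2)
  | .or φ χ => ((φ.eval e).1 ⊔ (χ.eval e).1, (φ.eval e).2 ⊓ (χ.eval e).2)
  | .imp φ χ => twistImp k (φ.eval e) (χ.eval e)
  | .coimp φ χ => twistCoimp k (φ.eval e) (χ.eval e)

/-- Entailment for `→, ⤙`: both coordinates count. Infima and suprema are taken in `[0,1]`, so
that `inf ∅ = 1` and `sup ∅ = 0`. -/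
def MoisilEntails {P : Type*} (Γ : Set (Formula .moisil P)) (φ : Formula .moisil P) : Prop :=
  ∀ e : P → unitInterval × unitInterval,
    (⨅ ψ ∈ Γ, (ψ.eval e).1) ≤ (φ.eval e).1 ∧ (φ.eval e).2 ≤ ⨆ ψ ∈ Γ, (ψ.eval e).2

/-- Entailment for `⥤, ⊸`: only the first coordinate counts. -/
def NelsonEntails {P : Type*} (Γ : Set (Formula .nelson P)) (φ : Formula .nelson P) : Prop :=
  ∀ e : P → unitInterval × unitInterval, (⨅ ψ ∈ Γ, (ψ.eval e).1) ≤ (φ.eval e).1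

/-! Soundness is an induction on derivations for the truth coordinate. For `→, ⤙` the falsity
coordinate follows, because conflation (swap the coordinates and apply `x ↦ 1 - x`) turns it into a
truth coordinate.

For completeness, the De Morgan axioms push `¬` down to the letters, so a valuation amounts to
independent values for `q` and `¬q`. Hence the Lindenbaum algebra is used only as a bi-Heyting
algebra with both prelinearity laws; in the Nelson case `¬` does not even respect provable
equivalence. If `φ` is not derivable from `Γ`, some prime ideal `J` contains `φ` and misses every
consequence of `Γ`. The complement of `J` need not be closed under the Baaz operator `Δ`, which a
quotient preserving co-implication requires. One therefore passes to `G = {a | Δa ∉ J}`, a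
`Δ`-closed prime filter: `a ⇨ b ∈ G` is a total preorder for which `J` is a lower set
(`exists_hom_of_isPrime`).

This countable chain embeds in `[0,1]` with a cut point at `J`
(`exists_unitInterval_representation`). The cut keeps the infimum over an infinite `Γ` strictly
above the value of `φ`, so no compactness is needed. -/

/-! ### Soundness -/

lemma gImp_eq_one_iff {a b : unitInterval} : gImp a b = 1 ↔ a ≤ b := by
  unfold gImp
  split_ifs with h
  · simp [h]
  · simp only [h, iff_false]
    rintro rfl
    exact h unitInterval.le_one'

lemma le_gImp_iff {a b c : unitInterval} : c ≤ gImp a b ↔ c ⊓ a ≤ b := by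
  unfold gImp
  split_ifs with h
  · simp [unitInterval.le_one', h]
  · simp [h]

lemma gImp_self (a : unitInterval) : gImp a a = 1 := gImp_eq_one_iff.2 le_rfl

namespace Formula

variable {k : Variant} {P : Type*}

lemma eval_biGAxiom {p : P} {φ : Formula k P} (h : BiGAxiom p φ)
    (e : P → unitInterval × unitInterval) : (φ.eval e).1 = 1 := by
  have h0 : (0 : unitInterval) = ⊥ := rfl
  have h1 : (1 : unitInterval) = ⊤ := rfl
  cases h <;> cases k <;>
    simp only [eval, twistImp, twistCoimp, top, bot, gneg, gImp_eq_one_iff, le_gImp_iff] <;>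
    (try simp only [gImp, gCoimp, le_refl, if_true, h0, h1]) <;> (try split_ifs) <;> order

lemma eval_deMorganAxiom {φ : Formula k P} (h : DeMorganAxiom φ)
    (e : P → unitInterval × unitInterval) : (φ.eval e).1 = 1 := by
  cases k <;> cases h <;> simp [iff, eval, twistImp, twistCoimp, gImp_self]

lemma le_eval_of_derivable {p : P} {Γ : Set (Formula k P)} {φ : Formula k P}
    (h : Derivable p Γ φ) (e : P → unitInterval × unitInterval) {c : unitInterval}
    (hc : ∀ ψ ∈ Γ, c ≤ (ψ.eval e).1) : c ≤ (φ.eval e).1 := by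
  induction h generalizing c with
  | hyp h => exact hc _ h
  | biG h => exact (eval_biGAxiom h e).symm ▸ unitInterval.le_one'
  | deMorgan h => exact (eval_deMorganAxiom h e).symm ▸ unitInterval.le_one'
  | mp _ _ ih₁ ih₂ =>
    have h₂ := ih₂ hc
    cases k <;> exact (le_inf le_rfl (ih₁ hc)).trans (le_gImp_iff.1 h₂)
  | nec _ ih =>
    -- The premise is a theorem, so no hypothesis bounds `c` and the value 1 is allowed.
    have h := ih (c := 1) (by simp)
    cases k <;> simp [eval, twistImp, twistCoimp, top, bot, gImp, gCoimp, h, unitInterval.le_one']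

lemma iInf_le_eval_of_derivable {p : P} {Γ : Set (Formula k P)} {φ : Formula k P}
    (h : Derivable p Γ φ) (e : P → unitInterval × unitInterval) :
    (⨅ ψ ∈ Γ, (ψ.eval e).1) ≤ (φ.eval e).1 :=
  le_eval_of_derivable h e fun _ hψ => iInf₂_le _ hψ

/-- The two coordinates of `→, ⤙` are exchanged by conflation. -/
lemma eval_conflation (e : P → unitInterval × unitInterval) (φ : Formula .moisil P) :
    φ.eval (fun q => (unitInterval.symm (e q).2, unitInterval.symm (e q).1)) =
      (unitInterval.symm (φ.eval e).2, unitInterval.symm (φ.eval e).1) := by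
  have hle : ∀ a b : unitInterval, unitInterval.symm a ≤ unitInterval.symm b ↔ b ≤ a :=
    fun a b => unitInterval.symm_le_symm
  have hmin : ∀ a b : unitInterval, unitInterval.symm (a ⊓ b) =
      unitInterval.symm a ⊔ unitInterval.symm b :=
    fun a b => unitInterval.strictAnti_symm.antitone.map_inf a b
  have hmax : ∀ a b : unitInterval, unitInterval.symm (a ⊔ b) =
      unitInterval.symm a ⊓ unitInterval.symm b :=
    fun a b => unitInterval.strictAnti_symm.antitone.map_sup a b
  induction φ with
  | atom q => rfl
  | neg φ ih => simp [eval, ih]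
  | and φ χ ih₁ ih₂ => simp [eval, ih₁, ih₂, hmin, hmax]
  | or φ χ ih₁ ih₂ => simp [eval, ih₁, ih₂, hmin, hmax]
  | imp φ χ ih₁ ih₂ =>
    simp only [eval, ih₁, ih₂, twistImp, gImp, gCoimp, hle, Prod.mk.injEq]
    constructor <;> split_ifs <;> simp
  | coimp φ χ ih₁ ih₂ =>
    simp only [eval, ih₁, ih₂, twistCoimp, gImp, gCoimp, hle, Prod.mk.injEq]
    constructor <;> split_ifs <;> simp

lemma eval_le_iSup_of_derivable {p : P} {Γ : Set (Formula .moisil P)} {φ : Formula .moisil P}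
    (h : Derivable p Γ φ) (e : P → unitInterval × unitInterval) :
    (φ.eval e).2 ≤ ⨆ ψ ∈ Γ, (ψ.eval e).2 := by
  have key := le_eval_of_derivable h
    (fun q => (unitInterval.symm (e q).2, unitInterval.symm (e q).1))
    (c := unitInterval.symm (⨆ ψ ∈ Γ, (ψ.eval e).2)) fun ψ hψ => by
      rw [eval_conflation]
      exact unitInterval.symm_le_symm.2 (le_iSup₂ (f := fun ψ _ => (eval e ψ).2) ψ hψ)
  rw [eval_conflation] at key
  exact unitInterval.symm_le_symm.1 key

end Formula

/-! ### Derived rules of the calculus -/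

namespace Derivable

open Formula

variable {k : Variant} {P : Type*} {p : P} {Γ : Set (Formula k P)} {φ χ ψ : Formula k P}

lemma of_empty (h : Derivable p ∅ φ) : Derivable p Γ φ := by
  generalize hΔ : (∅ : Set (Formula k P)) = Δ at h
  induction h with
  | hyp h => subst hΔ; exact h.elim
  | biG h => exact .biG h
  | deMorgan h => exact .deMorgan h
  | mp _ _ ih₁ ih₂ => exact .mp (ih₁ hΔ) (ih₂ hΔ)
  | nec h => exact .nec h

lemma weaken (φ χ : Formula k P) : Derivable p Γ (imp φ (imp χ φ)) :=
  .mp (.biG (.and_left φ χ)) (.biG (.curry φ χ φ))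

lemma imp_refl (φ : Formula k P) : Derivable p Γ (imp φ φ) :=
  -- With `T = φ → (φ → φ)`, already a theorem, currying `T ∧ φ → φ` gives `T → (φ → φ)`.
  .mp (weaken φ φ) (.mp (.biG (.and_right _ _)) (.biG (.curry (imp φ (imp φ φ)) φ φ)))

lemma imp_trans (h₁ : Derivable p Γ (imp φ χ)) (h₂ : Derivable p Γ (imp χ ψ)) :
    Derivable p Γ (imp φ ψ) :=
  .mp h₂ (.mp h₁ (.biG (.trans _ _ _)))

lemma imp_of (h : Derivable p Γ φ) (χ : Formula k P) : Derivable p Γ (imp χ φ) :=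
  .mp h (weaken _ _)

lemma imp_and (h₁ : Derivable p Γ (imp φ χ)) (h₂ : Derivable p Γ (imp φ ψ)) :
    Derivable p Γ (imp φ (and χ ψ)) :=
  .mp h₂ (.mp h₁ (.biG (.and_intro _ _ _)))

lemma or_imp (h₁ : Derivable p Γ (imp φ ψ)) (h₂ : Derivable p Γ (imp χ ψ)) :
    Derivable p Γ (imp (or φ χ) ψ) :=
  .mp h₂ (.mp h₁ (.biG (.or_elim _ _ _)))

lemma top_intro : Derivable p Γ (top p) := imp_refl _

lemma and_intro (h₁ : Derivable p Γ φ) (h₂ : Derivable p Γ χ) : Derivable p Γ (and φ χ) :=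
  .mp (top_intro (p := p)) (imp_and (imp_of h₁ _) (imp_of h₂ _))

lemma imp_imp_iff : Derivable p Γ (imp φ (imp χ ψ)) ↔ Derivable p Γ (imp (and φ χ) ψ) :=
  ⟨fun h => .mp h (.biG (.uncurry _ _ _)), fun h => .mp h (.biG (.curry _ _ _))⟩

/-- The converse direction is where necessitation enters, which confines it to theorems. -/
lemma gneg_coimp_iff : Derivable p ∅ (gneg p (coimp φ χ)) ↔ Derivable p ∅ (imp φ χ) :=
  ⟨fun h => .mp h (.biG (.gneg_coimp _ _)),
    fun h => imp_trans (.biG (.coimp_top _ _)) (.nec h)⟩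

/-- As `⊥` is `p ⤙ p`, the formula `⊥ ⤙ φ` implies `p ⤙ (p ∨ φ)`, which is refutable. -/
lemma bot_imp (φ : Formula k P) : Derivable p ∅ (imp (bot p) φ) := by
  refine gneg_coimp_iff.1 (imp_trans (.biG (.coimp_coimp _ _ _)) ?_)
  exact gneg_coimp_iff.2 (.biG (.or_left _ _))

lemma coimp_imp_iff :
    Derivable p ∅ (imp (coimp φ χ) ψ) ↔ Derivable p ∅ (imp φ (or χ ψ)) := by
  refine ⟨fun h => imp_trans (.biG (.coimp_or φ χ)) (or_imp (.biG (.or_left _ _))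
    (imp_trans h (.biG (.or_right _ _)))), fun h => gneg_coimp_iff.1 ?_⟩
  exact imp_trans (.biG (.coimp_coimp _ _ _)) (gneg_coimp_iff.2 h)

end Derivable

/-! ### The Lindenbaum algebra -/

/-- Provable equivalence. -/
def provableSetoid (k : Variant) {P : Type*} (p : P) : Setoid (Formula k P) where
  r φ χ := Derivable p ∅ (.imp φ χ) ∧ Derivable p ∅ (.imp χ φ)
  iseqv :=
    { refl := fun φ => ⟨.imp_refl φ, .imp_refl φ⟩
      symm := fun h => ⟨h.2, h.1⟩
      trans := fun h₁ h₂ => ⟨.imp_trans h₁.1 h₂.1, .imp_trans h₂.2 h₁.2⟩ }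

/-- The Lindenbaum algebra of the calculus. -/
def Lindenbaum (k : Variant) {P : Type*} (p : P) : Type _ := Quotient (provableSetoid k p)

namespace Lindenbaum

open Formula Derivable

variable {k : Variant} {P : Type*} {p : P}

/-- The class of a formula. -/
def mk (p : P) (φ : Formula k P) : Lindenbaum k p := Quotient.mk (provableSetoid k p) φ

instance : PartialOrder (Lindenbaum k p) where
  le := Quotient.lift₂ (fun φ χ => Derivable p ∅ (imp φ χ)) fun _ _ _ _ h₁ h₂ =>
    propext ⟨fun h => (h₁.2.imp_trans h).imp_trans h₂.1, fun h => (h₁.1.imp_trans h).imp_trans h₂.2⟩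
  le_refl := by rintro ⟨φ⟩; exact .imp_refl φ
  le_trans := by rintro ⟨φ⟩ ⟨χ⟩ ⟨ψ⟩ h₁ h₂; exact .imp_trans h₁ h₂
  le_antisymm := by rintro ⟨φ⟩ ⟨χ⟩ h₁ h₂; exact Quotient.sound ⟨h₁, h₂⟩

lemma mk_le_mk {φ χ : Formula k P} : mk p φ ≤ mk p χ ↔ Derivable p ∅ (imp φ χ) := Iff.rfl

lemma imp_mono {φ φ' χ χ' : Formula k P} (h₁ : Derivable p ∅ (imp φ' φ))
    (h₂ : Derivable p ∅ (imp χ χ')) : Derivable p ∅ (imp (imp φ χ) (imp φ' χ')) :=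
  imp_imp_iff.2 <| .imp_trans (imp_imp_iff.1 (.mp h₁ (.biG (.trans _ _ _)))) h₂

lemma coimp_mono {φ φ' χ χ' : Formula k P} (h₁ : Derivable p ∅ (imp φ φ'))
    (h₂ : Derivable p ∅ (imp χ' χ)) : Derivable p ∅ (imp (coimp φ χ) (coimp φ' χ')) :=
  coimp_imp_iff.2 <| h₁.imp_trans <| .imp_trans (.biG (.coimp_or φ' χ'))
    (or_imp (h₂.imp_trans (.biG (.or_left _ _))) (.biG (.or_right _ _)))

/-- Implication of classes. -/
def himp : Lindenbaum k p → Lindenbaum k p → Lindenbaum k p :=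
  Quotient.map₂ imp fun _ _ h₁ _ _ h₂ => ⟨imp_mono h₁.2 h₂.1, imp_mono h₁.1 h₂.2⟩

/-- Co-implication of classes. -/
def sdiff : Lindenbaum k p → Lindenbaum k p → Lindenbaum k p :=
  Quotient.map₂ coimp fun _ _ h₁ _ _ h₂ => ⟨coimp_mono h₁.1 h₂.2, coimp_mono h₁.2 h₂.1⟩

/-- Disjunction of classes. -/
def sup : Lindenbaum k p → Lindenbaum k p → Lindenbaum k p :=
  Quotient.map₂ or fun _ _ h₁ _ _ h₂ =>
    ⟨or_imp (h₁.1.imp_trans (.biG (.or_left _ _))) (h₂.1.imp_trans (.biG (.or_right _ _))),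
      or_imp (h₁.2.imp_trans (.biG (.or_left _ _))) (h₂.2.imp_trans (.biG (.or_right _ _)))⟩

/-- Conjunction of classes. -/
def inf : Lindenbaum k p → Lindenbaum k p → Lindenbaum k p :=
  Quotient.map₂ and fun _ _ h₁ _ _ h₂ =>
    ⟨imp_and (.imp_trans (.biG (.and_left _ _)) h₁.1) (.imp_trans (.biG (.and_right _ _)) h₂.1),
      imp_and (.imp_trans (.biG (.and_left _ _)) h₁.2) (.imp_trans (.biG (.and_right _ _)) h₂.2)⟩

instance : BiheytingAlgebra (Lindenbaum k p) where
  sup := sup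
  le_sup_left := by rintro ⟨φ⟩ ⟨χ⟩; exact .biG (.or_left φ χ)
  le_sup_right := by rintro ⟨φ⟩ ⟨χ⟩; exact .biG (.or_right φ χ)
  sup_le := by rintro ⟨φ⟩ ⟨χ⟩ ⟨ψ⟩ h₁ h₂; exact or_imp h₁ h₂
  inf := inf
  inf_le_left := by rintro ⟨φ⟩ ⟨χ⟩; exact .biG (.and_left φ χ)
  inf_le_right := by rintro ⟨φ⟩ ⟨χ⟩; exact .biG (.and_right φ χ)
  le_inf := by rintro ⟨φ⟩ ⟨χ⟩ ⟨ψ⟩ h₁ h₂; exact imp_and h₁ h₂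
  top := mk p (.top p)
  le_top := by rintro ⟨φ⟩; exact imp_of top_intro φ
  bot := mk p (.bot p)
  bot_le := by rintro ⟨φ⟩; exact bot_imp φ
  himp := himp
  le_himp_iff := by rintro ⟨φ⟩ ⟨χ⟩ ⟨ψ⟩; exact imp_imp_iff
  compl a := himp a (mk p (.bot p))
  himp_bot _ := rfl
  sdiff := sdiff
  sdiff_le_iff := by rintro ⟨φ⟩ ⟨χ⟩ ⟨ψ⟩; exact coimp_imp_iff
  hnot a := sdiff (mk p (.top p)) a
  top_sdiff _ := rfl

lemma mk_eq_top {φ : Formula k P} : mk p φ = ⊤ ↔ Derivable p ∅ φ :=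
  ⟨fun h => .mp top_intro (mk_le_mk.1 h.ge), fun h => top_le_iff.1 (mk_le_mk.2 (h.imp_of _))⟩

lemma mk_eq_mk_of_iff {φ χ : Formula k P} (h : Derivable p ∅ (Formula.iff φ χ)) :
    mk p φ = mk p χ :=
  Quotient.sound ⟨.mp h (.biG (.and_left _ _)), .mp h (.biG (.and_right _ _))⟩

lemma himp_sup_himp (a b : Lindenbaum k p) : (a ⇨ b) ⊔ (b ⇨ a) = ⊤ := by
  obtain ⟨φ⟩ := a
  obtain ⟨χ⟩ := b
  exact mk_eq_top.2 (.biG (.prel φ χ))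

lemma sdiff_inf_sdiff (a b : Lindenbaum k p) : (a \ b) ⊓ (b \ a) = ⊥ := by
  obtain ⟨φ⟩ := a
  obtain ⟨χ⟩ := b
  exact le_bot_iff.1 (mk_le_mk.2 (.biG (.coprel φ χ)))

end Lindenbaum

/-- Formulas of depth at most `n` form a countable set `S n`, by induction on `n`. -/
instance Formula.countable {k : Variant} {P : Type*} [Countable P] : Countable (Formula k P) := by
  let S : ℕ → Set (Formula k P) := fun n => n.rec (Set.range atom) fun _ T =>
    T ∪ neg '' T ∪ Set.image2 and T T ∪ Set.image2 or T T ∪ Set.image2 imp T T ∪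
      Set.image2 coimp T T
  have hS : ∀ n, (S n).Countable := by
    intro n
    induction n with
    | zero => exact Set.countable_range _
    | succ n ih =>
      exact ((((ih.union (ih.image _)).union (ih.image2 ih _)).union (ih.image2 ih _)).union
        (ih.image2 ih _)).union (ih.image2 ih _)
  have hsucc : ∀ n, S (n + 1) = S n ∪ neg '' S n ∪ Set.image2 and (S n) (S n) ∪
      Set.image2 or (S n) (S n) ∪ Set.image2 imp (S n) (S n) ∪ Set.image2 coimp (S n) (S n) :=
    fun _ => rfl
  have hmono : Monotone S := monotone_nat_of_le_succ fun n x hx => by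
    rw [hsucc]; simp [hx]
  have hmem : ∀ φ, ∃ n, φ ∈ S n := by
    have two : ∀ {φ χ : Formula k P}, (∃ n, φ ∈ S n) → (∃ n, χ ∈ S n) →
        ∃ n, φ ∈ S n ∧ χ ∈ S n := fun ⟨m, hm⟩ ⟨n, hn⟩ =>
      ⟨max m n, hmono (le_max_left _ _) hm, hmono (le_max_right _ _) hn⟩
    intro φ
    induction φ with
    | atom q => exact ⟨0, q, rfl⟩
    | neg φ ih =>
      obtain ⟨n, hn⟩ := ih
      exact ⟨n + 1, by rw [hsucc]; simp [hn]⟩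
    | and φ χ ih₁ ih₂ | or φ χ ih₁ ih₂ | imp φ χ ih₁ ih₂ | coimp φ χ ih₁ ih₂ =>
      obtain ⟨n, h₁, h₂⟩ := two ih₁ ih₂
      exact ⟨n + 1, by rw [hsucc]; simp [h₁, h₂]⟩
  refine Set.countable_univ_iff.1 ((Set.countable_iUnion hS).mono fun φ _ => ?_)
  exact Set.mem_iUnion.2 (hmem φ)

/-! ### The Baaz operator in bi-Gödel algebras -/

namespace BiGoedel

variable {α : Type*} [BiheytingAlgebra α]

/-- The Baaz operator `Δ`. -/
def delta (a : α) : α := (￢a)ᶜ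

lemma delta_mono {a b : α} (h : a ≤ b) : delta a ≤ delta b := compl_anti (hnot_anti h)

lemma delta_top : delta (⊤ : α) = ⊤ := by simp [delta]

lemma delta_le (a : α) : delta a ≤ a := by
  have h : (￢a)ᶜ ⊓ (a ⊔ ￢a) ≤ a := by
    rw [inf_sup_left]; simp
  simpa [delta] using h

lemma delta_inf (a b : α) : delta (a ⊓ b) = delta a ⊓ delta b := by
  simp [delta, compl_sup]

variable (hcoprel : ∀ a b : α, (a \ b) ⊓ (b \ a) = ⊥)
include hcoprel

/-- Since `a ⊔ ￢a = ⊤`, the two meetands lie below `a \ ￢a` and `￢a \ a`, which are disjoint. -/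
lemma hnot_hnot_inf_hnot (a : α) : ￢￢a ⊓ ￢a = ⊥ := by
  rw [← le_bot_iff, ← hcoprel (￢a) a, inf_comm]
  refine inf_le_inf ?_ ?_
  · rw [← top_sdiff' a, sdiff_le_iff, top_sdiff', ← sup_hnot_self a]
    exact sup_le le_sup_left le_sup_sdiff
  · rw [← top_sdiff' (￢a), sdiff_le_iff, ← sup_hnot_self a]
    exact sup_le le_sup_sdiff le_sup_left

lemma delta_sup_hnot (a : α) : delta a ⊔ ￢a = ⊤ := by
  have h : ￢￢a ≤ delta a := le_compl_iff_disjoint_right.2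
    (disjoint_iff.2 (hnot_hnot_inf_hnot hcoprel a))
  rw [← top_le_iff, ← sup_hnot_self (￢a), sup_comm]
  exact sup_le_sup_right h _

lemma delta_delta (a : α) : delta (delta a) = delta a := by
  refine (delta_le _).antisymm (compl_anti ?_)
  rw [← top_sdiff', sdiff_le_iff, delta_sup_hnot hcoprel]

/-- Modulo `￢(a ⊔ b)`, the meetands lie below `b \ a` and `a \ b`, which are disjoint. -/
lemma hnot_inf_hnot_le (a b : α) : ￢a ⊓ ￢b ≤ ￢(a ⊔ b) := by
  have key : ∀ a b : α, ￢a ≤ b \ a ⊔ ￢(a ⊔ b) := fun a b => by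
    rw [← top_sdiff' a, sdiff_le_iff, ← sup_hnot_self (a ⊔ b), ← sup_assoc]
    exact sup_le_sup_right (sup_le le_sup_left le_sup_sdiff) _
  have h := inf_le_inf (key a b) (sup_comm b a ▸ key b a)
  rwa [← sup_inf_right, hcoprel, bot_sup_eq] at h

/-- This makes `G` prime. Each `Δa` is complemented by `￢a`, and `Δ(a ⊔ b)` is disjoint from `￢a ⊓
￢b`. -/
lemma delta_sup (a b : α) : delta (a ⊔ b) ≤ delta a ⊔ delta b := by
  have h : delta (a ⊔ b) ⊓ ((delta a ⊔ ￢a) ⊓ (delta b ⊔ ￢b)) ≤ delta a ⊔ delta b := by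
    have h₁ : (delta a ⊔ ￢a) ⊓ (delta b ⊔ ￢b) ≤ (delta a ⊔ delta b) ⊔ ￢(a ⊔ b) := by
      refine le_trans ?_ (sup_le_sup_left (hnot_inf_hnot_le hcoprel a b) _)
      rw [sup_inf_left]
      exact inf_le_inf (sup_le_sup_right le_sup_left _) (sup_le_sup_right le_sup_right _)
    refine (inf_le_inf_left _ h₁).trans ?_
    rw [inf_sup_left]
    exact sup_le inf_le_right (by simp [delta])
  simpa [delta_sup_hnot hcoprel] using h

end BiGoedel

/-! ### Representation of cuts and chains in the unit interval -/

/-- A countable total preorder, together with a lower set, is represented by reals in the unit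
interval that leave a gap at the cut. -/
lemma exists_unitInterval_representation {α : Type*} [Countable α] {r : α → α → Prop}
    (refl : ∀ a, r a a) (trans : ∀ a b c, r a b → r b c → r a c) (total : ∀ a b, r a b ∨ r b a)
    {s : Set α} (hs : ∀ a b, r a b → b ∈ s → a ∈ s) {bot top : α} (hbot : ∀ a, r bot a)
    (htop : ∀ a, r a top) (hbs : bot ∈ s) (hts : top ∉ s) :
    ∃ (h : α → unitInterval) (c : unitInterval), (∀ a b, h a ≤ h b ↔ r a b) ∧ h bot = 0 ∧
      h top = 1 ∧ (∀ a ∈ s, h a < c) ∧ ∀ a ∉ s, c ≤ h a := by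
  classical
  obtain ⟨f, hf⟩ : ∃ f : α → Set.Ioo (0 : ℝ) 1, ∀ a b, f a ≤ f b ↔ r a b := by
    let _ : Preorder α := { le := r, le_refl := refl, le_trans := trans }
    have : @Std.Total α (· ≤ ·) := ⟨total⟩
    have : Nontrivial (Set.Ioo (0 : ℝ) 1) :=
      ⟨⟨1 / 2, by norm_num⟩, ⟨1 / 3, by norm_num⟩, by simp [Subtype.ext_iff]⟩
    have : Countable (Antisymmetrization α (· ≤ ·)) :=
      inferInstanceAs (Countable (Quotient _))
    obtain ⟨g⟩ := Order.embedding_from_countable_to_dense (Antisymmetrization α (· ≤ ·))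
      (Set.Ioo (0 : ℝ) 1)
    exact ⟨fun a => g (toAntisymmetrization (· ≤ ·) a), fun a b => by
      rw [g.le_iff_le, toAntisymmetrization_le_toAntisymmetrization_iff]; rfl⟩
  -- The lower set lands in `(0, 1)` and its complement in `(1, 2)`. An affine rescaling then sends
  -- the extremes to 0 and 1, and `c` is the image of 1.
  let g : α → ℝ := fun a => if a ∈ s then f a else f a + 1
  have hgs : ∀ a ∈ s, g a = f a := fun a ha => if_pos ha
  have hgn : ∀ a ∉ s, g a = f a + 1 := fun a ha => if_neg ha
  have hg : ∀ a b, g a ≤ g b ↔ r a b := by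
    intro a b
    have ha := (f a).2
    have hb := (f b).2
    rw [← hf, ← Subtype.coe_le_coe]
    by_cases has : a ∈ s <;> by_cases hbs : b ∈ s
    · rw [hgs a has, hgs b hbs]
    · rw [hgs a has, hgn b hbs]
      refine ⟨fun _ => ?_, fun _ => by linarith [ha.2, hb.1]⟩
      exact (hf a b).2 ((total a b).resolve_right fun h => hbs (hs _ _ h has))
    · rw [hgn a has, hgs b hbs]
      refine ⟨fun h => by linarith [ha.1, hb.2], fun h => ?_⟩
      exact absurd (hs _ _ ((hf a b).1 h) hbs) has
    · rw [hgn a has, hgn b hbs]; simp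
  have hgb : g bot < 1 := hgs bot hbs ▸ (f bot).2.2
  have hgt : 1 < g top := by rw [hgn top hts]; linarith [(f top).2.1]
  have hpos : 0 < g top - g bot := by linarith
  have hmem : ∀ x : ℝ, g bot ≤ x → x ≤ g top → (x - g bot) / (g top - g bot) ∈ unitInterval :=
    fun x h₁ h₂ => ⟨div_nonneg (by linarith) hpos.le, (div_le_one hpos).2 (by linarith)⟩
  refine ⟨fun a => ⟨_, hmem (g a) ((hg _ _).2 (hbot a)) ((hg _ _).2 (htop a))⟩,
    ⟨_, hmem 1 hgb.le hgt.le⟩, fun a b => ?_, ?_, ?_, fun a ha => ?_, fun a ha => ?_⟩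
  · rw [← Subtype.coe_le_coe, ← hg, div_le_div_iff_of_pos_right hpos, sub_le_sub_iff_right]
  · ext; simp
  · ext; simp [hpos.ne']
  · rw [← Subtype.coe_lt_coe, div_lt_div_iff_of_pos_right hpos, hgs a ha]
    exact sub_lt_sub_right (f a).2.2 _
  · rw [← Subtype.coe_le_coe, div_le_div_iff_of_pos_right hpos, hgn a ha]
    linarith [(f a).2.1]

namespace BiGoedel

open Order

variable {α : Type*} [BiheytingAlgebra α]

/-- Every prime ideal of a countable bi-Gödel algebra is separated from its complement by a
homomorphism to the unit interval. -/
theorem exists_hom_of_isPrime [Countable α] (hprel : ∀ a b : α, (a ⇨ b) ⊔ (b ⇨ a) = ⊤)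
    (hcoprel : ∀ a b : α, (a \ b) ⊓ (b \ a) = ⊥) {J : Ideal α} (hJ : J.IsPrime) :
    ∃ (h : α → unitInterval) (c : unitInterval), (∀ a b, h (a ⊓ b) = h a ⊓ h b) ∧
      (∀ a b, h (a ⊔ b) = h a ⊔ h b) ∧ (∀ a b, h (a ⇨ b) = gImp (h a) (h b)) ∧
      (∀ a b, h (a \ b) = gCoimp (h a) (h b)) ∧ (∀ a ∈ J, h a < c) ∧ ∀ a ∉ J, c ≤ h a := by
  let G : Set α := {a | delta a ∉ J}
  have topG : (⊤ : α) ∈ G := by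
    change delta ⊤ ∉ J
    rw [delta_top]
    exact hJ.toIsProper.top_notMem
  have upG : ∀ {a b}, a ≤ b → a ∈ G → b ∈ G := fun hab ha hb => ha (J.lower (delta_mono hab) hb)
  have infG : ∀ {a b}, a ∈ G → b ∈ G → a ⊓ b ∈ G := fun {a b} ha hb hab => by
    rw [delta_inf] at hab
    exact (hJ.mem_or_mem hab).elim ha hb
  have supG : ∀ {a b}, a ⊔ b ∈ G → a ∈ G ∨ b ∈ G := fun {a b} hab => by
    by_contra! hn
    exact hab (J.lower (delta_sup hcoprel a b)
      (J.sup_mem (not_not.1 hn.1) (not_not.1 hn.2)))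
  have deltaG : ∀ {a}, a ∈ G → delta a ∈ G := fun {a} ha => by
    change delta (delta a) ∉ J
    rwa [delta_delta hcoprel]
  have leG : ∀ {a b : α}, a ≤ b → a ⇨ b ∈ G := fun hab => himp_eq_top_iff.2 hab ▸ topG
  have transG : ∀ a b c : α, a ⇨ b ∈ G → b ⇨ c ∈ G → a ⇨ c ∈ G := fun a b c h₁ h₂ =>
    upG (himp_triangle a b c) (infG h₁ h₂)
  have totalG : ∀ a b : α, a ⇨ b ∈ G ∨ b ⇨ a ∈ G := fun a b => supG (hprel a b ▸ topG)
  have lowerJ : ∀ a b : α, a ⇨ b ∈ G → b ∈ J → a ∈ J := fun a b h hb => by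
    by_contra ha
    -- Primeness leaves `a ∈ J` or `a ⇨ b ∈ J`; the latter would put `Δ(a ⇨ b)` in `J`.
    refine (hJ.mem_or_mem (J.lower inf_himp_le hb)).elim ha fun h' => ?_
    exact h (J.lower (delta_le _) h')
  obtain ⟨h, c, hle, hbot, htop, hlt, hge⟩ :=
    exists_unitInterval_representation (r := fun a b : α => a ⇨ b ∈ G) (s := J)
      (fun a => leG le_rfl) transG totalG lowerJ (fun a => leG bot_le) (fun a => leG le_top)
      J.bot_mem hJ.toIsProper.top_notMem
  have hmono : Monotone h := fun a b hab => (hle a b).2 (leG hab)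
  refine ⟨h, c, fun a b => ?_, fun a b => ?_, fun a b => ?_, fun a b => ?_, hlt, hge⟩
  · refine le_antisymm (hmono.map_inf_le a b) ?_
    rcases totalG a b with hab | hab
    · exact inf_le_left.trans ((hle _ _).2 (by rwa [himp_inf_distrib, himp_self, top_inf_eq]))
    · exact inf_le_right.trans ((hle _ _).2 (by rwa [himp_inf_distrib, himp_self, inf_top_eq]))
  · refine le_antisymm ?_ (hmono.le_map_sup a b)
    rcases totalG a b with hab | hab
    · exact le_sup_of_le_right ((hle _ _).2 (by rwa [sup_himp_distrib, himp_self, inf_top_eq]))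
    · exact le_sup_of_le_left ((hle _ _).2 (by rwa [sup_himp_distrib, himp_self, top_inf_eq]))
  · unfold gImp
    split_ifs with hab
    · refine le_antisymm unitInterval.le_one' (htop ▸ (hle _ _).2 ?_)
      rw [top_himp]
      exact (hle a b).1 hab
    · have hab' : a ⇨ b ∉ G := fun h' => hab ((hle a b).2 h')
      refine le_antisymm ((hle _ _).2 ?_) (hmono le_himp)
      rcases totalG a (a ⇨ b) with h' | h'
      · rw [himp_himp, inf_idem] at h'
        exact absurd h' hab'
      · exact upG (le_himp_iff.2 ((le_inf (le_himp_iff.1 le_rfl) inf_le_right).trans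
          inf_himp_le)) h'
  · unfold gCoimp
    split_ifs with hab
    · refine le_antisymm (hbot ▸ (hle _ _).2 ?_) unitInterval.nonneg'
      rw [himp_bot]
      -- `Δ`-closure of `G` is needed here: `Δ(a ⇨ b) ≤ (a \ b)ᶜ`, because `a \ b ≤ ￢(a ⇨ b)`.
      refine upG (compl_anti ?_) (deltaG ((hle a b).1 hab))
      rw [sdiff_le_iff]
      calc a = a ⊓ (a ⇨ b) ⊔ a ⊓ ￢(a ⇨ b) := by rw [← inf_sup_left, sup_hnot_self, inf_top_eq]
        _ ≤ b ⊔ ￢(a ⇨ b) := sup_le_sup inf_himp_le inf_le_right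
    · have hab' : a ⇨ b ∉ G := fun h' => hab ((hle a b).2 h')
      refine le_antisymm (hmono sdiff_le) ((hle _ _).2 ?_)
      rcases totalG (a \ b) b with h' | h'
      · refine absurd (transG a (b ⊔ a \ b) b (leG le_sup_sdiff) ?_) hab'
        rwa [sup_himp_distrib, himp_self, top_inf_eq]
      · refine transG a (b ⊔ a \ b) _ (leG le_sup_sdiff) ?_
        rwa [sup_himp_distrib, himp_self, inf_top_eq]

end BiGoedel

/-! ### Completeness -/

open Order in
theorem Formula.exists_eval_lt_of_not_derivable {k : Variant} {P : Type*} [Countable P] {p : P}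
    {Γ : Set (Formula k P)} {φ : Formula k P} (hφ : ¬ Derivable p Γ φ) :
    ∃ e : P → unitInterval × unitInterval, (φ.eval e).1 < ⨅ ψ ∈ Γ, (ψ.eval e).1 := by
  let mk : Formula k P → Lindenbaum k p := Lindenbaum.mk p
  have hF : IsPFilter {a | ∃ ψ, mk ψ = a ∧ Derivable p Γ ψ} := by
    refine .of_def ⟨_, top p, rfl, .top_intro⟩ ?_ ?_
    · rintro _ ⟨ψ, rfl, hψ⟩ _ ⟨χ, rfl, hχ⟩
      exact ⟨mk (and ψ χ), ⟨_, rfl, hψ.and_intro hχ⟩, Lindenbaum.mk_le_mk.2 (.biG (.and_left ψ χ)),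
        Lindenbaum.mk_le_mk.2 (.biG (.and_right ψ χ))⟩
    · rintro _ ⟨χ⟩ hle ⟨ψ, rfl, hψ⟩
      exact ⟨χ, rfl, hψ.mp (Lindenbaum.mk_le_mk.1 hle).of_empty⟩
  obtain ⟨J, hJ, hφJ, hdisj⟩ := DistribLattice.prime_ideal_of_disjoint_filter_ideal
    (F := hF.toPFilter) (I := Ideal.principal (mk φ)) <| Set.disjoint_left.2 <| by
      rintro _ ⟨ψ, rfl, hψ⟩ hle
      exact hφ (hψ.mp (Lindenbaum.mk_le_mk.1 hle).of_empty)
  have : Countable (Lindenbaum k p) := inferInstanceAs (Countable (Quotient _))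
  obtain ⟨h, c, hinf, hsup, himp, hsdiff, hlt, hge⟩ := BiGoedel.exists_hom_of_isPrime
    Lindenbaum.himp_sup_himp Lindenbaum.sdiff_inf_sdiff hJ
  let e : P → unitInterval × unitInterval := fun q => (h (mk (atom q)), h (mk (neg (atom q))))
  -- Carrying `ψ` and `¬ψ` together lets the induction use one De Morgan axiom per connective.
  have heval : ∀ ψ : Formula k P, ψ.eval e = (h (mk ψ), h (mk (neg ψ))) := by
    have dm : ∀ {ψ χ : Formula k P}, DeMorganAxiom (iff ψ χ) → mk ψ = mk χ :=
      fun h => Lindenbaum.mk_eq_mk_of_iff (.deMorgan h)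
    intro ψ
    induction ψ with
    | atom q => rfl
    | neg ψ ih => rw [eval, ih, dm (.neg_neg ψ)]
    | and ψ χ ih₁ ih₂ =>
      rw [eval, ih₁, ih₂, dm (.neg_and ψ χ)]
      exact Prod.ext (hinf _ _).symm (hsup _ _).symm
    | or ψ χ ih₁ ih₂ =>
      rw [eval, ih₁, ih₂, dm (.neg_or ψ χ)]
      exact Prod.ext (hsup _ _).symm (hinf _ _).symm
    | imp ψ χ ih₁ ih₂ =>
      rw [eval, ih₁, ih₂]
      cases k with
      | moisil =>
        rw [dm (.moisil_imp ψ χ)]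
        exact Prod.ext (himp _ _).symm (hsdiff _ _).symm
      | nelson =>
        rw [dm (.nelson_imp ψ χ)]
        exact Prod.ext (himp _ _).symm (hinf _ _).symm
    | coimp ψ χ ih₁ ih₂ =>
      rw [eval, ih₁, ih₂]
      cases k with
      | moisil =>
        rw [dm (.moisil_coimp ψ χ)]
        exact Prod.ext (hsdiff _ _).symm (himp _ _).symm
      | nelson =>
        rw [dm (.nelson_coimp ψ χ)]
        exact Prod.ext (hsdiff _ _).symm (hsup _ _).symm
  refine ⟨e, lt_of_lt_of_le (b := c) ?_ (le_iInf₂ fun ψ hψ => ?_)⟩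
  · rw [heval]
    exact hlt _ (hφJ (le_refl (mk φ)))
  · rw [heval]
    exact hge _ (Set.disjoint_left.1 hdisj ⟨ψ, rfl, .hyp hψ⟩)

theorem mainTheorem5 {P : Type*} [Countable P] (p : P) :
    (∀ (Γ : Set (Formula .moisil P)) (φ : Formula .moisil P),
      Derivable p Γ φ ↔ MoisilEntails Γ φ) ∧
    (∀ (Γ : Set (Formula .nelson P)) (φ : Formula .nelson P),
      Derivable p Γ φ ↔ NelsonEntails Γ φ) := by
  refine ⟨fun Γ φ => ⟨fun h e => ⟨Formula.iInf_le_eval_of_derivable h e, Formula.eval_le_iSup_of_derivable h e⟩, fun h => ?_⟩,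
    fun Γ φ => ⟨fun h e => Formula.iInf_le_eval_of_derivable h e, fun h => ?_⟩⟩
  · by_contra hφ
    obtain ⟨e, he⟩ := Formula.exists_eval_lt_of_not_derivable hφ
    exact (h e).1.not_gt he
  · by_contra hφ
    obtain ⟨e, he⟩ := Formula.exists_eval_lt_of_not_derivable hφ
    exact (h e).not_gt he
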